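/- For each $k\ge 1$ let $M_k$ be a deterministic $m_k\times n_k$ real matrix with all entries in $[-1,1]$, where $m_k\to\infty$ and $n_k\to\infty$ as $k\to\infty$, and suppose that $\sup_k \operatorname{rank}(M_k)<\infty$. Let $\mathcal M\subset[-1,1]$ be the set of all entries of all the matrices $M_k$, and let $f:\mathcal M\to[0,1]$ be a function. For each $k$, a random set $S_k$ of positions in $\{1,\dots,m_k\}\times\{1,\dots,n_k\}$ is revealed: each position $(i,j)$ belongs to $S_k$ with probability $f((M_k)_{ij})$, independently over the positions. The revealed entries are observed without noise. Let $\mu_k=\frac1{m_kn_k}\sum_{i,j}\delta_{(M_k)_{ij}}$ be the empirical distribution of the entries of $M_k$. Suppose that for every probability measure $\mu$ on $[-1,1]$ that is the weak limit of some subsequence of $(\mu_k)$, there is a measurable function $g:[-1,1]\to[0,1]$ (which may depend on $\mu$) that extends $f$ and that is nonzero and continuous $\mu$-almost everywhere, i.e. for $\mu$-a.e. $x$, $g(x)\neq0$ and $g$ is continuous at $x$ as a function on $[-1,1]$. For each $k$ let $\hat M_k$ be a modified Candès–Recht estimator, i.e. a random matrix that (almost surely) minimizes the nuclear norm (the sum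 of the singular values) among all real $m_k\times n_k$ matrices that have all entries in $[-1,1]$ and that agree with $M_k$ at the positions in $S_k$. Then $\hat M_k$ is consistent: $$\lim_{k\to\infty}\ \mathbb E\Bigl[\frac1{m_kn_k}\sum_{i=1}^{m_k}\sum_{j=1}^{n_k}\bigl((\hat M_k)_{ij}-(M_k)_{ij}\bigr)^2\Bigr]=0 .$$ -/

import Mathlib

open MeasureTheory ProbabilityTheory Filter Topology
open scoped NNReal ENNReal unitInterval

noncomputable section

namespace MatrixCompletion

/-- The interval `[-1, 1]`, in which all matrix entries lie. -/
abbrev Entry : Type := Set.Icc (-1 : ℝ) 1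

/-- A matrix with entries in `[-1, 1]`, seen as a real matrix. -/
def toReal {m n : ℕ} (M : Matrix (Fin m) (Fin n) Entry) : Matrix (Fin m) (Fin n) ℝ :=
  M.map (fun x : Entry => (x : ℝ))

/-- The nuclear norm of a real matrix: the sum of its singular values. -/
def nuclearNorm {m n : ℕ} (A : Matrix (Fin m) (Fin n) ℝ) : ℝ :=
  (Matrix.toEuclideanLin A).singularValues.sum (fun _ s => s)

/-- The real matrices with all entries in `[-1, 1]` that agree with `M` on the set `S` of
revealed positions. -/
def feasible {m n : ℕ} (M : Matrix (Fin m) (Fin n) ℝ) (S : Set (Fin m × Fin n)) :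
    Set (Matrix (Fin m) (Fin n) ℝ) :=
  {A | (∀ i j, A i j ∈ Set.Icc (-1 : ℝ) 1) ∧ ∀ i j, (i, j) ∈ S → A i j = M i j}

/-- `A` is a modified Candès–Recht estimate of `M` when the positions in `S` are revealed: it
minimizes the nuclear norm among the matrices with entries in `[-1, 1]` that agree with `M` at
the revealed positions. -/
def IsModifiedCandesRecht {m n : ℕ} (M : Matrix (Fin m) (Fin n) ℝ) (S : Set (Fin m × Fin n))
    (A : Matrix (Fin m) (Fin n) ℝ) : Prop :=
  A ∈ feasible M S ∧ IsMinOn nuclearNorm (feasible M S) A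

/-- The empirical distribution `(1 / (m n)) ∑ i j, δ_{M i j}` of the entries of `M`, a probability
measure on `[-1, 1]` as soon as `m` and `n` are positive. -/
def empiricalDistribution {m n : ℕ} (M : Matrix (Fin m) (Fin n) Entry) : FiniteMeasure Entry :=
  ((m : ℝ≥0) * (n : ℝ≥0))⁻¹ • ∑ i, ∑ j, (diracProba (M i j)).toFiniteMeasure

/-- `μ` is the weak limit of the empirical distributions along some subsequence. -/
def IsSubseqWeakLimit {m n : ℕ → ℕ} (M : ∀ k, Matrix (Fin (m k)) (Fin (n k)) Entry)
    (μ : ProbabilityMeasure Entry) : Prop :=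
  ∃ φ : ℕ → ℕ, StrictMono φ ∧
    Tendsto (fun l => empiricalDistribution (M (φ l))) atTop (𝓝 μ.toFiniteMeasure)

/-- The set of all values that occur as an entry of one of the matrices `M k`. -/
def entries {m n : ℕ → ℕ} (M : ∀ k, Matrix (Fin (m k)) (Fin (n k)) Entry) : Set Entry :=
  {x | ∃ k i j, M k i j = x}

lemma mem_entries {m n : ℕ → ℕ} (M : ∀ k, Matrix (Fin (m k)) (Fin (n k)) Entry) (k : ℕ)
    (i : Fin (m k)) (j : Fin (n k)) : M k i j ∈ entries M :=
  ⟨k, i, j, rfl⟩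

/-- The mean squared error `𝔼 [(1 / (m n)) ∑ i j, (Mhat i j - M i j)^2]` of the random matrix
`Mhat` as an estimator of `M`. -/
def MSE {m n : ℕ} {Ω : Type*} [MeasurableSpace Ω] (P : Measure Ω)
    (M : Matrix (Fin m) (Fin n) ℝ) (Mhat : Ω → Matrix (Fin m) (Fin n) ℝ) : ℝ :=
  ∫ ω, (1 / ((m : ℝ) * (n : ℝ))) * ∑ i, ∑ j, (Mhat ω i j - M i j) ^ 2 ∂P

end MatrixCompletion

end

/-! Let `D = A - M` be the error of an estimate `A`, let `p` be the revelation probabilities, and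
let `ξ = 1_S - p`. Since `D` vanishes on `S`, `∑ p D² = -∑ ξ D²`. Expanding `D²` leaves sums `∑ ξ (B
∘ C)` over Hadamard products with `B, C ∈ {A, M}`. Both matrices have entries in `[-1, 1]` and
nuclear norm at most `√r √(mn)`: `M` by its rank, `A` by minimality.

Such sums are small uniformly in `B, C` once the operator norm of `ξ` is `o(√(mn))`
(`abs_sum_mul_mul_le`). A fourth-moment computation gives this in the mean
(`integral_gramEnergy_le`), so no knowledge of how `A` depends on `S` is needed.

It remains to pass from `∑ p D²` to `∑ D²`, for which `p` must be bounded below at most positions.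
Along a subsequence the empirical distributions converge, and the hypothesis on the limit provides
such a bound (`exists_eventually_sum_lt_le`). -/

namespace MatrixCompletion

/-! ### Singular values and the nuclear norm -/

/-- A singular value decomposition of a real matrix, in the form `A = ∑ k, u k ⊗ v k`, where `v` is
orthonormal, `u k` has norm `s k`, and `s` lists the singular values. -/
lemma exists_singular_decomposition {m n : ℕ} (A : Matrix (Fin m) (Fin n) ℝ) :
    ∃ (s : Fin n → ℝ) (u : Fin n → Fin m → ℝ) (v : Fin n → Fin n → ℝ),
      (∀ k, 0 ≤ s k) ∧ ∑ k, s k = nuclearNorm A ∧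
      (∀ i j, A i j = ∑ k, u k i * v k j) ∧
      (∀ k, ∑ i, u k i ^ 2 = s k ^ 2) ∧
      (∀ k l, ∑ j, v k j * v l j = if k = l then 1 else 0) ∧
      (∀ k i, ∑ j, A i j * v k j = u k i) ∧
      (∀ k j, ∑ i, A i j * u k i = s k ^ 2 * v k j) ∧
      (Finset.univ.filter (fun k => s k ≠ 0)).card = A.rank := by
  classical
  set T := Matrix.toEuclideanLin A with hTdef
  have hT := T.isSymmetric_adjoint_comp_self
  have hn : Module.finrank ℝ (EuclideanSpace ℝ (Fin n)) = n := finrank_euclideanSpace_fin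
  -- The `v k` are eigenvectors of `T* T` and `u k = T (v k)` is left unnormalized, so zero singular
  -- values need no separate treatment.
  set b := hT.eigenvectorBasis hn with hb
  have hTb : ∀ k i, (T (b k)) i = ∑ j, A i j * (b k) j := by
    intro k i
    simp [T, Matrix.toLpLin_apply, Matrix.mulVec, dotProduct]
  have hadj : ∀ k, LinearMap.adjoint T (T (b k)) = (T.singularValues k ^ 2) • b k := by
    intro k
    have := hT.apply_eigenvectorBasis hn k
    rw [T.sq_singularValues_fin hn k]
    exact this
  have hadjA : ∀ w : EuclideanSpace ℝ (Fin m), ∀ j,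
      (LinearMap.adjoint T w) j = ∑ i, A i j * w i := by
    intro w j
    rw [hTdef, ← Matrix.toEuclideanLin_conjTranspose_eq_adjoint]
    simp [Matrix.toLpLin_apply, Matrix.mulVec, dotProduct]
  have horth : ∀ k l, ∑ j, (b k) j * (b l) j = if k = l then 1 else 0 := by
    intro k l
    have := orthonormal_iff_ite.mp b.orthonormal k l
    rw [← this]
    simp [PiLp.inner_apply, mul_comm]
  have hsupp : T.singularValues.support ⊆ Finset.range n := by
    intro k hk
    by_contra h
    rw [Finset.mem_range, not_lt] at h
    exact (Finsupp.mem_support_iff.mp hk) (T.singularValues_of_finrank_le (hn.trans_le h))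
  refine ⟨fun k => T.singularValues k, fun k i => (T (b k)) i, fun k j => (b k) j,
    fun k => T.singularValues_nonneg k, ?_, ?_, ?_, horth, fun k i => (hTb k i).symm, ?_, ?_⟩
  · rw [nuclearNorm, Finsupp.sum_of_support_subset _ hsupp _ (by simp), Finset.sum_range]
  · intro i j
    have h1 := b.sum_repr (EuclideanSpace.single j (1 : ℝ))
    have h2 := congrArg (fun x => (T x) i) h1
    simp only [map_sum, map_smul, b.repr_apply_apply] at h2
    have h3 : (T (EuclideanSpace.single j (1 : ℝ))) i = A i j := by
      simp [T, Matrix.toLpLin_apply]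
    rw [h3] at h2
    rw [← h2]
    simp [EuclideanSpace.inner_single_right, mul_comm]
  · intro k
    have h1 : inner ℝ (T (b k)) (T (b k)) = T.singularValues k ^ 2 := by
      rw [← LinearMap.adjoint_inner_left, hadj, inner_smul_left]
      simp
    rw [← h1, PiLp.inner_apply]
    simp [sq]
  · intro k j
    have h := hadjA (T (b k)) j
    rw [← h, hadj]
    simp
  · have h1 : A.rank = T.singularValues.support.card := by
      rw [T.card_support_singularValues, hTdef, Matrix.rank_eq_finrank_range_toLin A
        (EuclideanSpace.basisFun (Fin m) ℝ).toBasis (EuclideanSpace.basisFun (Fin n) ℝ).toBasis]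
      rw [Matrix.toEuclideanLin_eq_toLin_orthonormal]
    rw [h1, ← Finset.card_map Fin.valEmbedding]
    congr 1
    ext k
    simp only [Finset.mem_map, Finset.mem_filter, Finset.mem_univ, true_and,
      Fin.valEmbedding_apply, Finsupp.mem_support_iff]
    constructor
    · rintro ⟨k, hk, rfl⟩
      exact hk
    · intro hk
      exact ⟨⟨k, Finset.mem_range.mp (hsupp (Finsupp.mem_support_iff.mpr hk))⟩, hk, rfl⟩

lemma sum_sq_sum_orthonormal {m n : ℕ} {κ : Type*} [DecidableEq κ] (F : Finset κ)
    (u : κ → Fin m → ℝ) (v : κ → Fin n → ℝ)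
    (hv : ∀ k l, ∑ j, v k j * v l j = if k = l then 1 else 0) :
    ∑ i, ∑ j, (∑ k ∈ F, u k i * v k j) ^ 2 = ∑ k ∈ F, ∑ i, u k i ^ 2 := by
  rw [Finset.sum_comm (s := F)]
  refine Finset.sum_congr rfl fun i _ => ?_
  calc ∑ j, (∑ k ∈ F, u k i * v k j) ^ 2
      = ∑ j, ∑ k ∈ F, ∑ l ∈ F, u k i * u l i * (v k j * v l j) := by
        refine Finset.sum_congr rfl fun j _ => ?_
        rw [sq, Finset.sum_mul_sum]
        exact Finset.sum_congr rfl fun k _ => Finset.sum_congr rfl fun l _ => by ring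
    _ = ∑ k ∈ F, ∑ l ∈ F, u k i * u l i * ∑ j, v k j * v l j := by
        rw [Finset.sum_comm]
        refine Finset.sum_congr rfl fun k _ => ?_
        rw [Finset.sum_comm]
        exact Finset.sum_congr rfl fun l _ => by rw [Finset.mul_sum]
    _ = ∑ k ∈ F, u k i ^ 2 := by
        refine Finset.sum_congr rfl fun k hk => ?_
        simp [hv, hk, sq]

/-- Cauchy–Schwarz over the nonzero singular values, of which there are `A.rank`. -/
lemma nuclearNorm_le_sqrt_rank {m n : ℕ} (A : Matrix (Fin m) (Fin n) ℝ) :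
    nuclearNorm A ≤ √(A.rank * ∑ i, ∑ j, A i j ^ 2) := by
  classical
  obtain ⟨s, u, v, hs, hsum, hA, hu, hv, -, -, hr⟩ := exists_singular_decomposition A
  have hF : ∑ i, ∑ j, A i j ^ 2 = ∑ k, s k ^ 2 := by
    simp_rw [← hu, hA]
    exact sum_sq_sum_orthonormal Finset.univ u v hv
  rw [← hsum, hF, ← hr]
  refine Real.le_sqrt_of_sq_le ?_
  rw [← Finset.sum_filter_ne_zero]
  refine sq_sum_le_card_mul_sum_sq.trans ?_
  gcongr
  exact Finset.filter_subset _ _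

lemma sqrt_sum_sq_mul_le {ι : Type*} [Fintype ι] (x y : ι → ℝ) {c d : ℝ} (hd : 0 ≤ d)
    (hc : 0 ≤ c) (hx : ∀ i, |x i| ≤ c) (hy : ∑ i, y i ^ 2 ≤ d ^ 2) :
    √(∑ i, (x i * y i) ^ 2) ≤ c * d := by
  refine Real.sqrt_le_iff.mpr ⟨by positivity, ?_⟩
  calc ∑ i, (x i * y i) ^ 2 ≤ ∑ i, c ^ 2 * y i ^ 2 := by
        refine Finset.sum_le_sum fun i _ => ?_
        rw [mul_pow]
        refine mul_le_mul_of_nonneg_right ?_ (sq_nonneg _)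
        exact sq_le_sq' (abs_le.mp (hx i)).1 (abs_le.mp (hx i)).2
    _ ≤ (c * d) ^ 2 := by
        rw [← Finset.mul_sum, mul_pow]
        gcongr

lemma abs_sum_mul_le_sqrt_mul {ι : Type*} [Fintype ι] (x y : ι → ℝ) {d : ℝ} (hd : 0 ≤ d)
    (hx : ∀ i, |x i| ≤ 1) (hy : ∑ i, y i ^ 2 ≤ d ^ 2) :
    |∑ i, x i * y i| ≤ √(Fintype.card ι) * d := by
  refine abs_le_of_sq_le_sq ?_ (by positivity)
  refine (Finset.sum_mul_sq_le_sq_mul_sq _ _ _).trans ?_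
  rw [mul_pow, Real.sq_sqrt (by positivity)]
  gcongr
  calc ∑ i, x i ^ 2 ≤ ∑ _i : ι, (1 : ℝ) :=
        Finset.sum_le_sum fun i _ => (sq_le_one_iff_abs_le_one _).mpr (hx i)
    _ = _ := by simp

/-! ### Hadamard products against a matrix of small operator norm -/

/-- The form `∑ ξ i j * A i j * B i j` is small for matrices `A`, `B` with bounded entries and
bounded normalized nuclear norm, as soon as the operator norm `t` of `ξ` is small. -/
lemma abs_sum_mul_mul_le {m n : ℕ} (A B ξ : Matrix (Fin m) (Fin n) ℝ) {K ε t : ℝ}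
    (hε : 0 < ε) (hK : 0 ≤ K) (ht : 0 ≤ t) (hm : 0 < m) (hn : 0 < n)
    (hA : ∀ i j, |A i j| ≤ 1) (hB : ∀ i j, |B i j| ≤ 1) (hξ : ∀ i j, |ξ i j| ≤ 1)
    (hop : ∀ (x : Fin m → ℝ) (y : Fin n → ℝ),
      |∑ i, ∑ j, ξ i j * x i * y j| ≤ t * √(∑ i, x i ^ 2) * √(∑ j, y j ^ 2))
    (hnA : nuclearNorm A ≤ K * √(m * n)) (hnB : nuclearNorm B ≤ K * √(m * n)) :
    |∑ i, ∑ j, ξ i j * (A i j * B i j)| ≤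
      m * n * √(ε * K) + K ^ 2 * √(m * n) * t / ε ^ 2 := by
  classical
  obtain ⟨s, u, v, hs, hsum, hAd, hu, hv, hAv, hAu, -⟩ := exists_singular_decomposition A
  obtain ⟨s', u', v', hs', hsum', hBd, hu', hv', -, -, -⟩ := exists_singular_decomposition B
  set N : ℝ := √(m * n) with hN
  have hmn : (0 : ℝ) < m * n := by positivity
  have hNpos : 0 < N := Real.sqrt_pos.mpr hmn
  have hN2 : N ^ 2 = m * n := Real.sq_sqrt hmn.le
  have hNmul : N = √m * √n := Real.sqrt_mul (by positivity) _
  -- The large singular values of `A`. The rest of `A` is small in Frobenius norm, while on `F`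
  -- division by `s k` is harmless.
  set F : Finset (Fin n) := Finset.univ.filter (fun k => ε * N ≤ s k) with hFdef
  have hsplit : ∑ i, ∑ j, ξ i j * (A i j * B i j) =
      (∑ k ∈ F, ∑ l, ∑ i, ∑ j, ξ i j * (u k i * u' l i) * (v k j * v' l j)) +
        ∑ i, ∑ j, ξ i j * B i j * (∑ k ∈ Fᶜ, u k i * v k j) := by
    have h1 : ∑ k ∈ F, ∑ l, ∑ i, ∑ j, ξ i j * (u k i * u' l i) * (v k j * v' l j) =
        ∑ i, ∑ j, ξ i j * B i j * ∑ k ∈ F, u k i * v k j := by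
      calc _ = ∑ k ∈ F, ∑ i, ∑ j, ∑ l, ξ i j * (u k i * u' l i) * (v k j * v' l j) := by
            refine Finset.sum_congr rfl fun k _ => ?_
            rw [Finset.sum_comm]
            exact Finset.sum_congr rfl fun i _ => Finset.sum_comm
        _ = ∑ i, ∑ j, ∑ k ∈ F, ∑ l, ξ i j * (u k i * u' l i) * (v k j * v' l j) := by
            rw [Finset.sum_comm]
            exact Finset.sum_congr rfl fun i _ => Finset.sum_comm
        _ = _ := by
            refine Finset.sum_congr rfl fun i _ => Finset.sum_congr rfl fun j _ => ?_
            rw [Finset.mul_sum]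
            refine Finset.sum_congr rfl fun k _ => ?_
            rw [hBd, Finset.mul_sum, Finset.sum_mul]
            exact Finset.sum_congr rfl fun l _ => by ring
    rw [h1, ← Finset.sum_add_distrib]
    refine Finset.sum_congr rfl fun i _ => ?_
    rw [← Finset.sum_add_distrib]
    refine Finset.sum_congr rfl fun j _ => ?_
    rw [← mul_add, Finset.sum_add_sum_compl, ← hAd]
    ring
  have hsmall : |∑ i, ∑ j, ξ i j * B i j * (∑ k ∈ Fᶜ, u k i * v k j)| ≤ m * n * √(ε * K) := by
    have hfro : ∑ p : Fin m × Fin n, (∑ k ∈ Fᶜ, u k p.1 * v k p.2) ^ 2 ≤ (√(ε * K) * N) ^ 2 := by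
      rw [Fintype.sum_prod_type, sum_sq_sum_orthonormal _ u v hv, mul_pow,
        Real.sq_sqrt (by positivity)]
      calc ∑ k ∈ Fᶜ, ∑ i, u k i ^ 2 ≤ ∑ k ∈ Fᶜ, ε * N * s k := by
            refine Finset.sum_le_sum fun k hk => ?_
            have hk' : s k < ε * N := by simpa [F] using hk
            rw [hu, sq]
            exact mul_le_mul_of_nonneg_right hk'.le (hs k)
        _ ≤ ∑ k, ε * N * s k :=
            Finset.sum_le_sum_of_subset_of_nonneg (Finset.subset_univ _)
              fun k _ _ => by have := hs k; positivity
        _ ≤ ε * N * (K * N) := by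
            rw [← Finset.mul_sum, hsum]
            gcongr
        _ = ε * K * N ^ 2 := by ring
    have := abs_sum_mul_le_sqrt_mul (fun p : Fin m × Fin n => ξ p.1 p.2 * B p.1 p.2) _
      (by positivity) (fun p => ?_) hfro
    · rw [Fintype.sum_prod_type] at this
      refine this.trans_eq ?_
      rw [Fintype.card_prod, Fintype.card_fin, Fintype.card_fin, Nat.cast_mul, ← hN, ← hN2]
      ring
    · rw [abs_mul]
      exact mul_le_one₀ (hξ _ _) (abs_nonneg _) (hB _ _)
  have hbig : |∑ k ∈ F, ∑ l, ∑ i, ∑ j, ξ i j * (u k i * u' l i) * (v k j * v' l j)| ≤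
      K ^ 2 * N * t / ε ^ 2 := by
    -- A Hadamard product of rank-one matrices has rank one, so `hop` applies. Bounded entries of
    -- `A` make its singular vectors bounded: apply Cauchy–Schwarz to `u k = A (v k)` and `s k ^ 2 •
    -- v k = Aᵀ (u k)`.
    have hterm : ∀ k ∈ F, ∀ l, |∑ i, ∑ j, ξ i j * (u k i * u' l i) * (v k j * v' l j)| ≤
        t / (ε ^ 2 * N) * (s k * s' l) := by
      intro k hk l
      have hk' : ε * N ≤ s k := by simpa [F] using hk
      have hsk : 0 < s k := lt_of_lt_of_le (by positivity) hk'
      have hub : ∀ i, |u k i| ≤ √n := by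
        intro i
        rw [← hAv]
        have := abs_sum_mul_le_sqrt_mul (fun j => A i j) (v k) zero_le_one (hA i)
          (by simpa [sq] using (hv k k).le)
        simpa using this
      have hvb : ∀ j, |v k j| ≤ √m / s k := by
        intro j
        have := abs_sum_mul_le_sqrt_mul (fun i => A i j) (u k) (hs k) (fun i => hA i j) (hu k).le
        rw [hAu, abs_mul, abs_of_nonneg (sq_nonneg (s k)), Fintype.card_fin] at this
        rw [le_div_iff₀ hsk]
        refine le_of_mul_le_mul_right ?_ hsk
        calc |v k j| * s k * s k = s k ^ 2 * |v k j| := by ring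
          _ ≤ _ := this
      refine (hop _ _).trans ?_
      have h1 := sqrt_sum_sq_mul_le (u k) (u' l) (hs' l) (Real.sqrt_nonneg _) hub (hu' l).le
      have h2 := sqrt_sum_sq_mul_le (v k) (v' l) zero_le_one (by positivity) hvb
        (by simpa [sq] using (hv' l l).le)
      calc t * √(∑ i, (u k i * u' l i) ^ 2) * √(∑ j, (v k j * v' l j) ^ 2)
          ≤ t * (√n * s' l) * (√m / s k * 1) := by
            have := hs' l
            gcongr
        _ = t * s' l * (N / s k) := by rw [hNmul]; ring
        -- Trading `1 / s k` for `s k` by means of `s k ≥ ε N` makes the sum over `k` a nuclear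
        -- norm.
        _ ≤ t * s' l * (s k / (ε ^ 2 * N)) := by
            refine mul_le_mul_of_nonneg_left ?_ (mul_nonneg ht (hs' l))
            rw [div_le_div_iff₀ hsk (by positivity)]
            calc N * (ε ^ 2 * N) = (ε * N) * (ε * N) := by ring
              _ ≤ s k * s k := by gcongr
        _ = _ := by ring
    calc _ ≤ ∑ k ∈ F, ∑ l, t / (ε ^ 2 * N) * (s k * s' l) := by
          refine (Finset.abs_sum_le_sum_abs _ _).trans (Finset.sum_le_sum fun k hk => ?_)
          exact (Finset.abs_sum_le_sum_abs _ _).trans (Finset.sum_le_sum fun l _ => hterm k hk l)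
      _ ≤ ∑ k, ∑ l, t / (ε ^ 2 * N) * (s k * s' l) := by
          refine Finset.sum_le_sum_of_subset_of_nonneg (Finset.subset_univ _) fun k _ _ =>
            Finset.sum_nonneg fun l _ => ?_
          have := hs k
          have := hs' l
          positivity
      _ = t / (ε ^ 2 * N) * (nuclearNorm A * nuclearNorm B) := by
          rw [← hsum, ← hsum', Finset.sum_mul_sum, Finset.mul_sum]
          exact Finset.sum_congr rfl fun k _ => by rw [Finset.mul_sum]
      _ ≤ t / (ε ^ 2 * N) * ((K * N) * (K * N)) := by
          have : 0 ≤ nuclearNorm B := hsum' ▸ Finset.sum_nonneg fun k _ => hs' k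
          gcongr
      _ = K ^ 2 * N * t / ε ^ 2 := by
          field_simp
  rw [hsplit]
  refine (abs_add_le _ _).trans ?_
  linarith

/-! ### Operator norm of the centered noise -/

/-- The fourth power of the Schatten 4-norm: the squared Frobenius norm of the Gram matrix. -/
noncomputable def gramEnergy {m n : ℕ} (ξ : Matrix (Fin m) (Fin n) ℝ) : ℝ :=
  ∑ i, ∑ i', (∑ j, ξ i j * ξ i' j) ^ 2

lemma gramEnergy_nonneg {m n : ℕ} (ξ : Matrix (Fin m) (Fin n) ℝ) : 0 ≤ gramEnergy ξ :=
  Finset.sum_nonneg fun _ _ => Finset.sum_nonneg fun _ _ => sq_nonneg _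

/-- `‖ξᵀ x‖²` is the inner product of `ξ ξᵀ` with `x xᵀ`, hence at most the Frobenius norm of `ξ ξᵀ`
times `‖x‖²`. -/
lemma abs_sum_mul_mul_le_gramEnergy {m n : ℕ} (ξ : Matrix (Fin m) (Fin n) ℝ)
    (x : Fin m → ℝ) (y : Fin n → ℝ) :
    |∑ i, ∑ j, ξ i j * x i * y j| ≤
      √(√(gramEnergy ξ)) * √(∑ i, x i ^ 2) * √(∑ j, y j ^ 2) := by
  set z : Fin n → ℝ := fun j => ∑ i, ξ i j * x i with hz
  have h1 : ∑ i, ∑ j, ξ i j * x i * y j = ∑ j, z j * y j := by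
    rw [Finset.sum_comm]
    exact Finset.sum_congr rfl fun j _ => by rw [hz, Finset.sum_mul]
  have h2 : ∑ j, z j ^ 2 =
      ∑ p : Fin m × Fin m, (∑ j, ξ p.1 j * ξ p.2 j) * (x p.1 * x p.2) := by
    rw [Fintype.sum_prod_type]
    calc ∑ j, z j ^ 2 = ∑ j, ∑ i, ∑ i', ξ i j * ξ i' j * (x i * x i') := by
          refine Finset.sum_congr rfl fun j _ => ?_
          rw [sq, hz, Finset.sum_mul_sum]
          exact Finset.sum_congr rfl fun i _ => Finset.sum_congr rfl fun i' _ => by ring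
      _ = _ := by
          rw [Finset.sum_comm]
          refine Finset.sum_congr rfl fun i _ => ?_
          rw [Finset.sum_comm]
          exact Finset.sum_congr rfl fun i' _ => by rw [Finset.sum_mul]
  have h3 : ∑ j, z j ^ 2 ≤ √(gramEnergy ξ) * ∑ i, x i ^ 2 := by
    have h := Finset.sum_mul_sq_le_sq_mul_sq (Finset.univ : Finset (Fin m × Fin m))
      (fun p => ∑ j, ξ p.1 j * ξ p.2 j) (fun p => x p.1 * x p.2)
    rw [← h2] at h
    have h4 : ∑ p : Fin m × Fin m, (x p.1 * x p.2) ^ 2 = (∑ i, x i ^ 2) ^ 2 := by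
      rw [Fintype.sum_prod_type, sq (∑ i, x i ^ 2), Finset.sum_mul_sum]
      exact Finset.sum_congr rfl fun i _ => Finset.sum_congr rfl fun i' _ => by ring
    have h5 : ∑ p : Fin m × Fin m, (∑ j, ξ p.1 j * ξ p.2 j) ^ 2 = gramEnergy ξ := by
      rw [Fintype.sum_prod_type, gramEnergy]
    rw [h4, h5] at h
    have hx : 0 ≤ ∑ i, x i ^ 2 := Finset.sum_nonneg fun _ _ => sq_nonneg _
    refine le_of_sq_le_sq ?_ (by positivity)
    rw [mul_pow, Real.sq_sqrt (gramEnergy_nonneg ξ)]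
    exact h
  rw [h1]
  calc |∑ j, z j * y j| ≤ √(∑ j, z j ^ 2) * √(∑ j, y j ^ 2) := by
        rw [← Real.sqrt_mul (Finset.sum_nonneg fun _ _ => sq_nonneg _)]
        exact Real.abs_le_sqrt (Finset.sum_mul_sq_le_sq_mul_sq _ _ _)
    _ ≤ √(√(gramEnergy ξ) * ∑ i, x i ^ 2) * √(∑ j, y j ^ 2) := by gcongr
    _ = _ := by rw [Real.sqrt_mul (Real.sqrt_nonneg _)]

lemma integrable_of_abs_le {Ω : Type*} [MeasurableSpace Ω] {P : Measure Ω} [IsFiniteMeasure P]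
    {X : Ω → ℝ} (hX : AEMeasurable X P) {c : ℝ} (h : ∀ᵐ ω ∂P, |X ω| ≤ c) : Integrable X P :=
  Integrable.of_bound hX.aestronglyMeasurable c h

/-- The expected Gram energy of a matrix of independent centered bounded random variables. -/
lemma integral_gramEnergy_le {m n : ℕ} {Ω : Type*} [MeasurableSpace Ω] {P : Measure Ω}
    [IsProbabilityMeasure P] (X : Fin m × Fin n → Ω → ℝ) (hmeas : ∀ p, Measurable (X p))
    (hindep : iIndepFun X P) (hbdd : ∀ p ω, |X p ω| ≤ 1) (hmean : ∀ p, ∫ ω, X p ω ∂P = 0) :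
    ∫ ω, gramEnergy (fun i j => X (i, j) ω) ∂P ≤ m * n ^ 2 + m ^ 2 * n := by
  have hprod : ∀ p q ω, |X p ω * X q ω| ≤ 1 := fun p q ω => by
    rw [abs_mul]
    exact mul_le_one₀ (hbdd _ _) (abs_nonneg _) (hbdd _ _)
  have hprod4 : ∀ p q r s ω, |X p ω * X q ω * (X r ω * X s ω)| ≤ 1 := fun p q r s ω => by
    rw [abs_mul]
    exact mul_le_one₀ (hprod _ _ _) (abs_nonneg _) (hprod _ _ _)
  have hint4 : ∀ p q r s, Integrable (fun ω => X p ω * X q ω * (X r ω * X s ω)) P :=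
    fun p q r s => integrable_of_abs_le
      (((hmeas p).mul (hmeas q)).mul ((hmeas r).mul (hmeas s))).aemeasurable
      (ae_of_all _ (hprod4 p q r s))
  have hexp : ∀ i i' ω, (∑ j, X (i, j) ω * X (i', j) ω) ^ 2 =
      ∑ j, ∑ j', X (i, j) ω * X (i', j) ω * (X (i, j') ω * X (i', j') ω) := fun i i' ω => by
    rw [sq, Finset.sum_mul_sum]
  have hle4 : ∀ p q r s, ∫ ω, X p ω * X q ω * (X r ω * X s ω) ∂P ≤ 1 := fun p q r s => by
    calc _ ≤ ∫ _ω, (1 : ℝ) ∂P := integral_mono (hint4 p q r s) (integrable_const _)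
          fun ω => (abs_le.mp (hprod4 p q r s ω)).2
      _ = 1 := by simp
  -- The four positions are distinct, so the expectation factors over columns and then over rows.
  -- Only terms with `i = i'` or `j = j'` survive.
  have hzero : ∀ i i' j j', i ≠ i' → j ≠ j' →
      ∫ ω, X (i, j) ω * X (i', j) ω * (X (i, j') ω * X (i', j') ω) ∂P = 0 := by
    intro i i' j j' hi hj
    have h1 := (hindep.indepFun_prodMk_prodMk hmeas (i, j) (i', j) (i, j') (i', j')
      (by simp [hj]) (by simp [hj]) (by simp [hj]) (by simp [hj])).comp
        (measurable_fst.mul measurable_snd) (measurable_fst.mul measurable_snd)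
    have h2 := hindep.indepFun (show (i, j) ≠ (i', j) by simp [hi])
    have h3 := h1.integral_fun_mul_eq_mul_integral
      ((hmeas (i, j)).mul (hmeas (i', j))).aestronglyMeasurable
      ((hmeas (i, j')).mul (hmeas (i', j'))).aestronglyMeasurable
    have h4 := h2.integral_fun_mul_eq_mul_integral
      (hmeas (i, j)).aestronglyMeasurable (hmeas (i', j)).aestronglyMeasurable
    rw [hmean, zero_mul] at h4
    refine h3.trans ?_
    exact mul_eq_zero_of_left h4 _
  have hterm : ∀ i i', ∫ ω, (∑ j, X (i, j) ω * X (i', j) ω) ^ 2 ∂P ≤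
      (if i = i' then (n : ℝ) ^ 2 else 0) + n := by
    intro i i'
    simp_rw [hexp]
    rw [integral_finsetSum _ fun j _ => integrable_finsetSum _ fun j' _ => hint4 _ _ _ _]
    simp_rw [integral_finsetSum _ fun j' _ => hint4 _ _ _ _]
    split_ifs with h
    · calc _ ≤ ∑ _j : Fin n, ∑ _j' : Fin n, (1 : ℝ) :=
            Finset.sum_le_sum fun j _ => Finset.sum_le_sum fun j' _ => hle4 _ _ _ _
        _ = (n : ℝ) ^ 2 := by simp [sq]
        _ ≤ _ := by simp
    · calc _ ≤ ∑ j : Fin n, ∑ j' : Fin n, (if j = j' then (1 : ℝ) else 0) := by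
            refine Finset.sum_le_sum fun j _ => Finset.sum_le_sum fun j' _ => ?_
            split_ifs with hj
            · exact hle4 _ _ _ _
            · exact (hzero i i' j j' h hj).le
        _ = _ := by simp
  have hintsq : ∀ i i', Integrable (fun ω => (∑ j, X (i, j) ω * X (i', j) ω) ^ 2) P := by
    intro i i'
    simp_rw [hexp]
    exact integrable_finsetSum _ fun j _ => integrable_finsetSum _ fun j' _ => hint4 _ _ _ _
  unfold gramEnergy
  rw [integral_finsetSum _ fun i _ => integrable_finsetSum _ fun i' _ => hintsq i i']
  simp_rw [integral_finsetSum _ fun i' _ => hintsq _ i']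
  calc _ ≤ ∑ i : Fin m, ∑ i' : Fin m, ((if i = i' then (n : ℝ) ^ 2 else 0) + n) :=
        Finset.sum_le_sum fun i _ => Finset.sum_le_sum fun i' _ => hterm i i'
    _ = _ := by
        simp [Finset.sum_add_distrib]
        ring

lemma integrable_gramEnergy {m n : ℕ} {Ω : Type*} [MeasurableSpace Ω] {P : Measure Ω}
    [IsProbabilityMeasure P] (X : Fin m × Fin n → Ω → ℝ) (hmeas : ∀ p, Measurable (X p))
    (hbdd : ∀ p ω, |X p ω| ≤ 1) :
    Integrable (fun ω => gramEnergy (fun i j => X (i, j) ω)) P := by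
  unfold gramEnergy
  refine integrable_finsetSum _ fun i _ => integrable_finsetSum _ fun i' _ => ?_
  refine integrable_of_abs_le (c := (n : ℝ) ^ 2)
    (Measurable.aemeasurable (by fun_prop)) (ae_of_all _ fun ω => ?_)
  rw [abs_pow]
  gcongr
  refine (Finset.abs_sum_le_sum_abs _ _).trans ?_
  calc _ ≤ ∑ _j : Fin n, (1 : ℝ) := Finset.sum_le_sum fun j _ => by
        rw [abs_mul]
        exact mul_le_one₀ (hbdd _ _) (abs_nonneg _) (hbdd _ _)
    _ = _ := by simp

/-- Bounds the operator norm `t` by an expression linear in `t ^ 4`, to be replaced by the Gram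
energy, whose expectation is known. -/
lemma le_add_pow_four_div {t η : ℝ} (ht : 0 ≤ t) (hη : 0 < η) : t ≤ η + t ^ 4 / η ^ 3 := by
  rcases le_total t η with h | h
  · have : 0 ≤ t ^ 4 / η ^ 3 := by positivity
    linarith
  · have : t ≤ t ^ 4 / η ^ 3 := by
      rw [le_div_iff₀ (by positivity)]
      calc t * η ^ 3 ≤ t * t ^ 3 := by gcongr
        _ = t ^ 4 := by ring
    linarith

/-! ### Weak limits of the empirical distributions -/

lemma empiricalDistribution_real {m n : ℕ} (M : Matrix (Fin m) (Fin n) Entry) {s : Set Entry}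
    (hs : MeasurableSet s) :
    ((empiricalDistribution M : FiniteMeasure Entry) : Measure Entry).real s =
      ((m : ℝ) * n)⁻¹ * ∑ i, ∑ j, s.indicator 1 (M i j) := by
  have h : ∀ x : Entry, ((diracProba x).toFiniteMeasure : FiniteMeasure Entry) s
      = s.indicator (1 : Entry → ℝ≥0) x := by
    intro x
    rw [← ENNReal.coe_inj, FiniteMeasure.ennreal_coeFn_eq_coeFn_toMeasure]
    have := diracProba_toMeasure_apply' x hs
    by_cases hx : x ∈ s <;> simp [hx]
  have h2 : (empiricalDistribution M) s =
      ((m : ℝ≥0) * n)⁻¹ * ∑ i, ∑ j, s.indicator (1 : Entry → ℝ≥0) (M i j) := by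
    have hsum : ∀ (ι : Type) (F : Finset ι) (ρ : ι → FiniteMeasure Entry),
        (∑ i ∈ F, ρ i) s = ∑ i ∈ F, ρ i s := fun ι F ρ => by
      classical
      induction F using Finset.induction_on with
      | empty => simp
      | insert a F ha ih => rw [Finset.sum_insert ha, Finset.sum_insert ha, ← ih]; simp
    simp only [empiricalDistribution, FiniteMeasure.smul_apply, hsum, h, smul_eq_mul]
  have h3 : ((empiricalDistribution M : FiniteMeasure Entry) : Measure Entry).real s =
      ((empiricalDistribution M s : ℝ≥0) : ℝ) := rfl
  rw [h3, h2]
  push_cast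
  congr 1

lemma isProbabilityMeasure_empiricalDistribution {m n : ℕ} (M : Matrix (Fin m) (Fin n) Entry)
    (hm : 0 < m) (hn : 0 < n) :
    IsProbabilityMeasure ((empiricalDistribution M : FiniteMeasure Entry) : Measure Entry) := by
  have h := empiricalDistribution_real M MeasurableSet.univ
  have h1 : ((m : ℝ) * n)⁻¹ * (m * n) = 1 := inv_mul_cancel₀ (by positivity)
  constructor
  rw [← ENNReal.toReal_eq_one_iff, ← Measure.real, h]
  simpa using h1

/-- If the empirical distributions converge to `μ` and `g` is nonzero and continuous `μ`-a.e., then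
the proportion of entries at which `g < δ` is eventually small, for some `δ > 0`. -/
lemma exists_eventually_sum_lt_le {m n : ℕ → ℕ} (hm : ∀ᶠ l in atTop, 0 < m l)
    (hn : ∀ᶠ l in atTop, 0 < n l) (M : ∀ l, Matrix (Fin (m l)) (Fin (n l)) Entry)
    (μ : ProbabilityMeasure Entry) (ν : ℕ → ProbabilityMeasure Entry)
    (hν : ∀ᶠ l in atTop, (ν l).toFiniteMeasure = empiricalDistribution (M l))
    (hlim : Tendsto ν atTop (𝓝 μ)) (g : Entry → I)
    (hg : ∀ᵐ x ∂(μ : Measure Entry), g x ≠ 0 ∧ ContinuousAt g x) {ε : ℝ} (hε : 0 < ε) :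
    ∃ δ : ℝ, 0 < δ ∧ ∀ᶠ l in atTop,
      ∑ i, ∑ j, (if (g (M l i j) : ℝ) < δ then (1 : ℝ) else 0) ≤ ε * (m l * n l) := by
  classical
  -- Interiors are taken because the portmanteau lower bound needs open sets. A point where `g` is
  -- positive and continuous lies in some `U N`, so these sets exhaust `μ`.
  set U : ℕ → Set Entry := fun N => interior {x | 1 / ((N : ℝ) + 1) ≤ g x} with hU
  have hmono : Monotone U := by
    intro a b hab
    refine interior_mono fun x hx => ?_
    have hle : 1 / ((b : ℝ) + 1) ≤ 1 / ((a : ℝ) + 1) := by gcongr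
    exact hle.trans hx
  have hfull : (μ : Measure Entry) (⋃ N, U N) = 1 := by
    rw [prob_compl_eq_zero_iff (MeasurableSet.iUnion fun N => isOpen_interior.measurableSet)
      |>.symm]
    refine measure_mono_null (fun x hx => ?_) hg
    intro hx'
    refine hx (Set.mem_iUnion.mpr ?_)
    have hpos : (0 : ℝ) < g x := lt_of_le_of_ne (g x).2.1 fun h => hx'.1 (Subtype.ext h.symm)
    obtain ⟨N, hN⟩ := exists_nat_one_div_lt hpos
    refine ⟨N, mem_interior_iff_mem_nhds.mpr ?_⟩
    have hc : ContinuousAt (fun y => (g y : ℝ)) x := continuous_subtype_val.continuousAt.comp hx'.2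
    filter_upwards [hc.eventually (lt_mem_nhds hN)] with y hy using hy.le
  have htend := tendsto_measure_iUnion_atTop (μ := (μ : Measure Entry)) hmono
  rw [hfull] at htend
  have hlt : ENNReal.ofReal (1 - ε) < 1 := by
    rw [ENNReal.ofReal_lt_one]
    linarith
  obtain ⟨N, hN⟩ := (htend.eventually (lt_mem_nhds hlt)).exists
  refine ⟨1 / ((N : ℝ) + 1), by positivity, ?_⟩
  have hopen : IsOpen (U N) := isOpen_interior
  have hlow := ProbabilityMeasure.le_liminf_measure_open_of_tendsto hlim hopen
  have hev := eventually_lt_of_lt_liminf (hN.trans_le hlow)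
  filter_upwards [hev, hν, hm, hn] with l hl hνl hml hnl
  have hpos : (0 : ℝ) < m l * n l := by positivity
  have h1 : 1 - ε < ((ν l : ProbabilityMeasure Entry) : Measure Entry).real (U N) := by
    by_contra hle
    refine hl.not_ge ?_
    rw [← ENNReal.ofReal_toReal (measure_ne_top _ (U N))]
    exact ENNReal.ofReal_le_ofReal (not_lt.mp hle)
  have h2 : ((ν l : ProbabilityMeasure Entry) : Measure Entry) =
      ((empiricalDistribution (M l) : FiniteMeasure Entry) : Measure Entry) := by
    rw [← hνl]
    rfl
  rw [h2, empiricalDistribution_real _ hopen.measurableSet, inv_mul_eq_div, lt_div_iff₀ hpos] at h1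
  have h3 : ∑ i, ∑ j, (if (g (M l i j) : ℝ) < 1 / ((N : ℝ) + 1) then (1 : ℝ) else 0) ≤
      ∑ i, ∑ j, (1 - (U N).indicator (1 : Entry → ℝ) (M l i j)) := by
    refine Finset.sum_le_sum fun i _ => Finset.sum_le_sum fun j _ => ?_
    by_cases hx : M l i j ∈ U N
    · have : ¬ ((g (M l i j) : ℝ) < 1 / ((N : ℝ) + 1)) := 
        not_lt.mpr (interior_subset (s := {x | 1 / ((N : ℝ) + 1) ≤ g x}) hx)
      rw [if_neg this]
      simp [hx]
    · rw [Set.indicator_of_notMem hx]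
      split_ifs <;> norm_num
  refine h3.trans ?_
  simp only [Finset.sum_sub_distrib, Finset.sum_const, Finset.card_univ, Fintype.card_fin,
    nsmul_eq_mul, mul_one]
  linarith

lemma exists_subseq_tendsto (ν : ℕ → ProbabilityMeasure Entry) :
    ∃ μ : ProbabilityMeasure Entry, ∃ φ : ℕ → ℕ, StrictMono φ ∧ Tendsto (ν ∘ φ) atTop (𝓝 μ) :=
  CompactSpace.tendsto_subseq ν

/-! ### Error bounds -/

/-- Deterministic error bound in terms of the centered revelation matrix `ξ = 1_S - p`. -/
lemma sum_sq_error_le {m n : ℕ} (hm : 0 < m) (hn : 0 < n) (M A p ξ : Matrix (Fin m) (Fin n) ℝ)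
    (S : Set (Fin m × Fin n)) {r δ ε η β : ℝ} (hr : 0 ≤ r) (hδ : 0 < δ) (hε : 0 < ε) (hη : 0 < η)
    (hM : ∀ i j, M i j ∈ Set.Icc (-1 : ℝ) 1) (hrank : (M.rank : ℝ) ≤ r)
    (hp : ∀ i j, 0 ≤ p i j) (hξ : ∀ i j, |ξ i j| ≤ 1)
    (hξS : ∀ i j, (i, j) ∉ S → ξ i j = -p i j)
    (hbad : ∑ i, ∑ j, (if p i j < δ then (1 : ℝ) else 0) ≤ β * (m * n))
    (hA : IsModifiedCandesRecht M S A) :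
    1 / ((m : ℝ) * n) * ∑ i, ∑ j, (A i j - M i j) ^ 2 ≤
      4 * β + 4 / δ * (√(ε * √r) +
        r / ε ^ 2 * (η + gramEnergy ξ / (η ^ 3 * ((m : ℝ) * n) ^ 2))) := by
  obtain ⟨⟨hAI, hAS⟩, hmin⟩ := hA
  set N : ℝ := √(m * n) with hN
  have hmn : (0 : ℝ) < m * n := by positivity
  have hNpos : 0 < N := Real.sqrt_pos.mpr hmn
  have hN2 : N ^ 2 = m * n := Real.sq_sqrt hmn.le
  have hM1 : ∀ i j, |M i j| ≤ 1 := fun i j => abs_le.mpr (hM i j)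
  have hA1 : ∀ i j, |A i j| ≤ 1 := fun i j => abs_le.mpr (hAI i j)
  have hnM : nuclearNorm M ≤ √r * N := by
    refine (nuclearNorm_le_sqrt_rank M).trans ?_
    rw [hN, ← Real.sqrt_mul hr]
    refine Real.sqrt_le_sqrt (mul_le_mul hrank ?_ (Finset.sum_nonneg fun _ _ =>
      Finset.sum_nonneg fun _ _ => sq_nonneg _) hr)
    calc ∑ i, ∑ j, M i j ^ 2 ≤ ∑ _i : Fin m, ∑ _j : Fin n, (1 : ℝ) :=
          Finset.sum_le_sum fun i _ => Finset.sum_le_sum fun j _ =>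
            (sq_le_one_iff_abs_le_one _).mpr (hM1 i j)
      _ = m * n := by simp
  have hnA : nuclearNorm A ≤ √r * N :=
    (isMinOn_iff.mp hmin M ⟨hM, fun _ _ _ => rfl⟩).trans hnM
  set t := √(√(gramEnergy ξ)) with ht
  have ht0 : 0 ≤ t := Real.sqrt_nonneg _
  have ht4 : t ^ 4 = gramEnergy ξ := by
    rw [show t ^ 4 = (t ^ 2) ^ 2 by ring, ht, Real.sq_sqrt (Real.sqrt_nonneg _),
      Real.sq_sqrt (gramEnergy_nonneg ξ)]
  set R := m * n * √(ε * √r) + √r ^ 2 * N * t / ε ^ 2 with hR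
  have key : ∀ B C : Matrix (Fin m) (Fin n) ℝ, (∀ i j, |B i j| ≤ 1) → (∀ i j, |C i j| ≤ 1) →
      nuclearNorm B ≤ √r * N → nuclearNorm C ≤ √r * N →
      |∑ i, ∑ j, ξ i j * (B i j * C i j)| ≤ R := fun B C hB hC hnB hnC =>
    abs_sum_mul_mul_le B C ξ hε (Real.sqrt_nonneg r) ht0 hm hn hB hC hξ
      (abs_sum_mul_mul_le_gramEnergy ξ) hnB hnC
  have hpD : ∑ i, ∑ j, p i j * (A i j - M i j) ^ 2 ≤ 4 * R := by
    -- On `S` both sides vanish because `A = M`; off `S`, `ξ = -p`. The coefficients `1, 2, 1`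
    -- account for the factor `4`.
    have h1 : ∑ i, ∑ j, p i j * (A i j - M i j) ^ 2 =
        -(∑ i, ∑ j, ξ i j * (A i j * A i j)) + 2 * ∑ i, ∑ j, ξ i j * (A i j * M i j)
          - ∑ i, ∑ j, ξ i j * (M i j * M i j) := by
      simp only [Finset.mul_sum, ← Finset.sum_neg_distrib, ← Finset.sum_add_distrib,
        ← Finset.sum_sub_distrib]
      refine Finset.sum_congr rfl fun i _ => Finset.sum_congr rfl fun j _ => ?_
      by_cases h : (i, j) ∈ S
      · rw [hAS i j h]
        ring
      · rw [hξS i j h]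
        ring
    have h2 := abs_le.mp (key A A hA1 hA1 hnA hnA)
    have h3 := abs_le.mp (key A M hA1 hM1 hnA hnM)
    have h4 := abs_le.mp (key M M hM1 hM1 hnM hnM)
    rw [h1]
    linarith [h2.1, h3.2, h4.1]
  have hD : ∑ i, ∑ j, (A i j - M i j) ^ 2 ≤ 4 * (β * (m * n)) + 4 * R / δ := by
    calc ∑ i, ∑ j, (A i j - M i j) ^ 2
        ≤ ∑ i, ∑ j, (4 * (if p i j < δ then (1 : ℝ) else 0) +
            p i j * (A i j - M i j) ^ 2 / δ) := by
          refine Finset.sum_le_sum fun i _ => Finset.sum_le_sum fun j _ => ?_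
          split_ifs with h
          · have h1 : 0 ≤ p i j * (A i j - M i j) ^ 2 / δ := by
              have := hp i j
              positivity
            have h2 : (A i j - M i j) ^ 2 ≤ 2 ^ 2 := by
              refine sq_le_sq' ?_ ?_ <;>
                linarith [(hAI i j).1, (hAI i j).2, (hM i j).1, (hM i j).2]
            linarith
          · rw [mul_zero, zero_add, le_div_iff₀ hδ, mul_comm]
            exact mul_le_mul_of_nonneg_right (not_lt.mp h) (sq_nonneg _)
      _ = 4 * (∑ i, ∑ j, (if p i j < δ then (1 : ℝ) else 0)) +
            (∑ i, ∑ j, p i j * (A i j - M i j) ^ 2) / δ := by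
          simp only [Finset.mul_sum, Finset.sum_div, Finset.sum_add_distrib]
      _ ≤ _ := by gcongr
  have hRle : R ≤ m * n * (√(ε * √r) +
      r / ε ^ 2 * (η + gramEnergy ξ / (η ^ 3 * ((m : ℝ) * n) ^ 2))) := by
    -- The scale `η N` makes both terms of the bound proportional to `N²` after multiplication by
    -- `N`.
    have h1 := le_add_pow_four_div ht0 (mul_pos hη hNpos)
    rw [ht4] at h1
    calc R = m * n * √(ε * √r) + r / ε ^ 2 * (N * t) := by
          rw [hR, Real.sq_sqrt hr]
          ring
      _ ≤ m * n * √(ε * √r) + r / ε ^ 2 * (N * (η * N + gramEnergy ξ / (η * N) ^ 3)) := by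
          gcongr
      _ = _ := by
          have h2 : N * (η * N + gramEnergy ξ / (η * N) ^ 3) =
              N ^ 2 * (η + gramEnergy ξ / (η ^ 3 * (N ^ 2) ^ 2)) := by
            field_simp
          rw [h2, hN2]
          ring
  calc 1 / ((m : ℝ) * n) * ∑ i, ∑ j, (A i j - M i j) ^ 2
      ≤ 1 / ((m : ℝ) * n) * (4 * (β * (m * n)) + 4 * (m * n * (√(ε * √r) +
        r / ε ^ 2 * (η + gramEnergy ξ / (η ^ 3 * ((m : ℝ) * n) ^ 2)))) / δ) := by
        refine mul_le_mul_of_nonneg_left (hD.trans ?_) (by positivity)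
        gcongr
    _ = _ := by
        generalize √(ε * √r) + r / ε ^ 2 * (η + gramEnergy ξ / (η ^ 3 * ((m : ℝ) * n) ^ 2)) = Y
        field_simp

/-- Quantitative bound for the mean squared error, when all but a proportion `β` of the entries are
revealed with probability at least `δ`. -/
lemma MSE_le {m n : ℕ} (hm : 0 < m) (hn : 0 < n) {Ω : Type*} [MeasurableSpace Ω]
    (P : Measure Ω) [IsProbabilityMeasure P] (M p : Matrix (Fin m) (Fin n) ℝ)
    (S : Ω → Set (Fin m × Fin n)) (hS_meas : ∀ q, MeasurableSet {ω | q ∈ S ω})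
    (hS_indep : iIndepSet (fun q => {ω | q ∈ S ω}) P)
    (hS_prob : ∀ i j, P.real {ω | (i, j) ∈ S ω} = p i j)
    (Mhat : Ω → Matrix (Fin m) (Fin n) ℝ)
    (hMhat : ∀ᵐ ω ∂P, IsModifiedCandesRecht M (S ω) (Mhat ω))
    {r δ ε η β : ℝ} (hr : 0 ≤ r) (hδ : 0 < δ) (hε : 0 < ε) (hη : 0 < η)
    (hM : ∀ i j, M i j ∈ Set.Icc (-1 : ℝ) 1) (hrank : (M.rank : ℝ) ≤ r)
    (hbad : ∑ i, ∑ j, (if p i j < δ then (1 : ℝ) else 0) ≤ β * (m * n)) :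
    MSE P M Mhat ≤ 4 * β + 4 / δ * (√(ε * √r) +
        r / ε ^ 2 * (η + ((m : ℝ)⁻¹ + (n : ℝ)⁻¹) / η ^ 3)) := by
  classical
  set X : Fin m × Fin n → Ω → ℝ := fun q ω =>
    ({ω | q ∈ S ω}.indicator (fun _ => (1 : ℝ)) ω) - p q.1 q.2 with hX
  have hp0 : ∀ i j, 0 ≤ p i j := fun i j => hS_prob i j ▸ measureReal_nonneg
  have hp1 : ∀ i j, p i j ≤ 1 := fun i j => hS_prob i j ▸ measureReal_le_one
  have hXmeas : ∀ q, Measurable (X q) := fun q =>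
    (measurable_const.indicator (hS_meas q)).sub_const _
  have hXindep : iIndepFun X P :=
    (hS_indep.iIndepFun_indicator (β := ℝ)).comp (fun q x => x - p q.1 q.2)
      fun q => measurable_id.sub_const _
  have hXbdd : ∀ q ω, |X q ω| ≤ 1 := by
    intro q ω
    have h0 := hp0 q.1 q.2
    have h1 := hp1 q.1 q.2
    simp only [hX, Set.indicator_apply]
    split_ifs <;> rw [abs_le] <;> constructor <;> linarith
  have hXmean : ∀ q, ∫ ω, X q ω ∂P = 0 := by
    intro q
    simp only [hX]
    rw [integral_sub ((integrable_const _).indicator (hS_meas q)) (integrable_const _),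
      integral_indicator_const _ (hS_meas q)]
    simp [hS_prob]
  have hXS : ∀ ω i j, (i, j) ∉ S ω → X (i, j) ω = -p i j := by
    intro ω i j h
    simp [hX, h]
  set Y : Ω → ℝ := fun ω => gramEnergy (fun i j => X (i, j) ω) with hY
  have hYint : Integrable Y P := integrable_gramEnergy X hXmeas hXbdd
  have hYle : ∫ ω, Y ω ∂P ≤ m * n ^ 2 + m ^ 2 * n :=
    integral_gramEnergy_le X hXmeas hXindep hXbdd hXmean
  have hm' : (0 : ℝ) < m := by positivity
  have hn' : (0 : ℝ) < n := by positivity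
  set a := 4 * β + 4 / δ * (√(ε * √r) + r / ε ^ 2 * η) with ha
  set b := 4 / δ * (r / ε ^ 2 / (η ^ 3 * ((m : ℝ) * n) ^ 2)) with hb
  have hb0 : 0 ≤ b := by positivity
  calc MSE P M Mhat ≤ ∫ ω, (a + b * Y ω) ∂P := by
        refine integral_mono_of_nonneg (ae_of_all _ fun ω => ?_)
          ((integrable_const a).add (hYint.const_mul b)) ?_
        · exact mul_nonneg (by positivity) (Finset.sum_nonneg fun _ _ =>
            Finset.sum_nonneg fun _ _ => sq_nonneg _)
        · filter_upwards [hMhat] with ω hω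
          refine (sum_sq_error_le hm hn M (Mhat ω) p (fun i j => X (i, j) ω) (S ω) hr hδ hε hη hM
            hrank hp0 (fun i j => hXbdd _ ω) (hXS ω) hbad hω).trans_eq ?_
          simp only [ha, hb, hY]
          ring
    _ = a + b * ∫ ω, Y ω ∂P := by
        rw [integral_add (integrable_const a) (hYint.const_mul b), integral_const_mul]
        simp
    _ ≤ a + b * (m * n ^ 2 + m ^ 2 * n) := by gcongr
    _ = _ := by
        rw [ha, hb]
        field_simp
        ring

end MatrixCompletion

/-! ### Subsequences and choice of parameters -/

theorem theorem2p2
    -- the parameter matrices `M k`, of order `m k × n k`, with entries in `[-1, 1]`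
    (m n : ℕ → ℕ) (hm : Tendsto m atTop atTop) (hn : Tendsto n atTop atTop)
    (M : ∀ k, Matrix (Fin (m k)) (Fin (n k)) MatrixCompletion.Entry)
    -- uniformly bounded rank
    (hrank : ∃ r : ℕ, ∀ k, (MatrixCompletion.toReal (M k)).rank ≤ r)
    -- the revelation probability, a function on the set of all entries
    (f : MatrixCompletion.entries M → I)
    -- every subsequential weak limit `μ` admits an extension of `f`, nonzero and continuous `μ`-a.e.
    (hf : ∀ μ : ProbabilityMeasure MatrixCompletion.Entry,
      MatrixCompletion.IsSubseqWeakLimit M μ →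
        ∃ g : MatrixCompletion.Entry → I, Measurable g ∧
          (∀ x : MatrixCompletion.entries M, g x = f x) ∧
          ∀ᵐ x ∂(μ : Measure MatrixCompletion.Entry), g x ≠ 0 ∧ ContinuousAt g x)
    -- the random set `S k ω` of revealed positions: each position is revealed independently, with
    -- probability given by `f` at the entry
    (Ω : ℕ → Type*) [∀ k, MeasurableSpace (Ω k)]
    (P : ∀ k, Measure (Ω k)) [∀ k, IsProbabilityMeasure (P k)]
    (S : ∀ k, Ω k → Set (Fin (m k) × Fin (n k)))
    (hS_meas : ∀ k p, MeasurableSet {ω | p ∈ S k ω})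
    (hS_indep : ∀ k, iIndepSet (fun p => {ω | p ∈ S k ω}) (P k))
    (hS_prob : ∀ k i j, (P k).real {ω | (i, j) ∈ S k ω} =
      (f ⟨M k i j, MatrixCompletion.mem_entries M k i j⟩ : ℝ))
    -- a modified Candès–Recht estimator, computed from the revealed entries of `X k = M k`
    (Mhat : ∀ k, Ω k → Matrix (Fin (m k)) (Fin (n k)) ℝ)
    (hMhat_meas : ∀ k i j, AEMeasurable (fun ω => Mhat k ω i j) (P k))
    (hMhat : ∀ k, ∀ᵐ ω ∂(P k),
      MatrixCompletion.IsModifiedCandesRecht (MatrixCompletion.toReal (M k)) (S k ω) (Mhat k ω)) :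
    Tendsto (fun k => MatrixCompletion.MSE (P k) (MatrixCompletion.toReal (M k)) (Mhat k))
      atTop (𝓝 0) := by
  classical
  open MatrixCompletion in
  obtain ⟨r, hr⟩ := hrank
  set ν : ℕ → ProbabilityMeasure Entry := fun k =>
    if h : 0 < m k ∧ 0 < n k then
      ⟨empiricalDistribution (M k), isProbabilityMeasure_empiricalDistribution (M k) h.1 h.2⟩
    else diracProba ⟨0, by norm_num⟩ with hν
  have hνeq : ∀ k, 0 < m k → 0 < n k → (ν k).toFiniteMeasure = empiricalDistribution (M k) := by
    intro k h1 h2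
    have h : ν k = ⟨empiricalDistribution (M k),
        isProbabilityMeasure_empiricalDistribution (M k) h1 h2⟩ := dif_pos ⟨h1, h2⟩
    rw [h]
    rfl
  have hm0 := hm.eventually_gt_atTop 0
  have hn0 := hn.eventually_gt_atTop 0
  refine tendsto_of_subseq_tendsto fun ψ hψ => ?_
  -- `ψ` merely tends to infinity, whereas a subsequential weak limit requires a strictly increasing
  -- index; `τ` repairs this before compactness gives `φ`.
  obtain ⟨τ, -, hτ⟩ := strictMono_subseq_of_tendsto_atTop hψ
  obtain ⟨μ, φ, hφ, hlim⟩ := exists_subseq_tendsto (ν ∘ ψ ∘ τ)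
  refine ⟨τ ∘ φ, ?_⟩
  set κ : ℕ → ℕ := ψ ∘ τ ∘ φ with hκ
  have hκm : StrictMono κ := hτ.comp hφ
  have hκt := hκm.tendsto_atTop
  have hνev : ∀ᶠ l in atTop, (ν (κ l)).toFiniteMeasure = empiricalDistribution (M (κ l)) := by
    filter_upwards [hκt.eventually hm0, hκt.eventually hn0] with l h1 h2 using hνeq _ h1 h2
  have hlim' : Tendsto (fun l => ν (κ l)) atTop (𝓝 μ) := hlim
  obtain ⟨g, -, hgf, hg⟩ := hf μ ⟨κ, hκm,
    ((ProbabilityMeasure.tendsto_nhds_iff_toFiniteMeasure_tendsto_nhds _).mp hlim').congr' hνev⟩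
  have hinv : Tendsto (fun l => ((m (κ l) : ℝ))⁻¹ + ((n (κ l) : ℝ))⁻¹) atTop (𝓝 0) := by
    have h1 := (tendsto_inv_atTop_nhds_zero_nat (𝕜 := ℝ)).comp (hm.comp hκt)
    have h2 := (tendsto_inv_atTop_nhds_zero_nat (𝕜 := ℝ)).comp (hn.comp hκt)
    simpa [Function.comp_def] using (h1.add h2 : Tendsto _ _ (𝓝 ((0 : ℝ) + 0)))
  refine tendsto_order.mpr ⟨fun a ha => Eventually.of_forall fun l => ha.trans_le ?_,
    fun θ hθ => ?_⟩
  · exact integral_nonneg fun ω => mul_nonneg (by positivity) (Finset.sum_nonneg fun _ _ =>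
      Finset.sum_nonneg fun _ _ => sq_nonneg _)
  -- Each of the four terms of `MSE_le` gets `θ / 4`; the bad proportion enters as `4 β`, hence `θ /
  -- 16`. The choices are made in the order `δ`, `ε`, `η`, then large `l`.
  obtain ⟨δ, hδ, hbad⟩ := exists_eventually_sum_lt_le (m := m ∘ κ) (n := n ∘ κ)
    (hκt.eventually hm0) (hκt.eventually hn0)
    (fun l => M (κ l)) μ (fun l => ν (κ l)) hνev hlim' g hg (show 0 < θ / 16 by positivity)
  obtain ⟨ε, hε, hεpos⟩ : ∃ ε : ℝ, 4 / δ * √(ε * √r) < θ / 4 ∧ 0 < ε := by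
    have hc : Tendsto (fun ε : ℝ => 4 / δ * √(ε * √r)) (𝓝[>] 0) (𝓝 0) :=
      tendsto_nhdsWithin_of_tendsto_nhds
        ((by fun_prop : Continuous fun ε : ℝ => 4 / δ * √(ε * √r)).tendsto' _ _ (by simp))
    exact ((hc.eventually (gt_mem_nhds (by positivity))).and self_mem_nhdsWithin).exists
  obtain ⟨η, hη, hηpos⟩ : ∃ η : ℝ, 4 / δ * (r / ε ^ 2 * η) < θ / 4 ∧ 0 < η := by
    have hc : Tendsto (fun η : ℝ => 4 / δ * (r / ε ^ 2 * η)) (𝓝[>] 0) (𝓝 0) :=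
      tendsto_nhdsWithin_of_tendsto_nhds
        ((by fun_prop : Continuous fun η : ℝ => 4 / δ * (r / ε ^ 2 * η)).tendsto' _ _ (by simp))
    exact ((hc.eventually (gt_mem_nhds (by positivity))).and self_mem_nhdsWithin).exists
  have hlast : ∀ᶠ l in atTop, 4 / δ * (r / ε ^ 2 *
      ((((m (κ l) : ℝ))⁻¹ + ((n (κ l) : ℝ))⁻¹) / η ^ 3)) < θ / 4 := by
    have hc := (((hinv.div_const (η ^ 3)).const_mul (r / ε ^ 2)).const_mul (4 / δ))
    simp only [zero_div, mul_zero] at hc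
    exact hc.eventually (gt_mem_nhds (by positivity))
  filter_upwards [hlast, hbad, hκt.eventually hm0, hκt.eventually hn0] with l h1 h2 h3 h4
  refine (MSE_le h3 h4 (P (κ l)) (toReal (M (κ l))) (fun i j => (g (M (κ l) i j) : ℝ)) (S (κ l))
    (hS_meas _) (hS_indep _) (fun i j => ?_) (Mhat (κ l)) (hMhat _) (Nat.cast_nonneg r) hδ hεpos
    hηpos (fun i j => (M (κ l) i j).2) (by exact_mod_cast hr (κ l)) h2).trans_lt ?_
  · rw [hS_prob, ← hgf]
  · linarith
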